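/- Let $P$ be a finite set of proposition letters and $I$ a finite index set. A labeled transition system (LTS) $M_a$ consists of a set of states $\mathrm{dom}(M)$, a distinguished state $a$, a subset $p^M\subseteq \mathrm{dom}(M)$ for each $p\in P$ and a binary relation $R_i^M$ on $\mathrm{dom}(M)$ for each $i\in I$; it is image-finite if every state $m$ has only finitely many successors, i.e. states $n$ with $R_i^M(m,n)$ for some $i\in I$. Homomorphisms preserve the distinguished state and all the relations $p$ and $R_i$. A directed path of length $r$ from $s_0$ to $s_r$ is a sequence of facts $R_{i_1}(s_0,s_1),\dots,R_{i_r}(s_{r-1},s_r)$ (with $r\ge 0$). The depth of a state is the length of a shortest directed path from the distinguished state to it. A tree is an LTS in which each state is reached from the distinguished state by exactly one directed path; its depth is the supremum of the depths of its states. The unraveling $\mathtt{unr}(M_a)$ is the tree whose states are the directed paths $\pi$ of $M$ that start at $a$, with the empty path as distinguished state, where $\pi$ satisfies $p$ iff its last state lies in $p^M$, and where $R_i(\pi,\pi')$ holds iff $\pi'$ is $\pi$ extended by one fact $R_i(\mathrm{last}(\pi),u)$ of $M$; $\mathtt{unr}^k(M_a)$ is its substructure of states of depth at most $k$. Graded modal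 logic has the formulas $\varphi ::= \top \mid p \mid \neg\varphi \mid \varphi\wedge\varphi\mid\varphi\vee\varphi\mid\Diamond_i\varphi\mid\Box_i\varphi\mid\Diamond_i^{\ge n}\varphi$ ($p \in P$, $i\in I$, $n\geq 1$), where $\Diamond_i^{\ge n}\varphi$ says that at least $n$ distinct $R_i$-successors satisfy $\varphi$; the modal depth is the maximal nesting depth of modalities. Let $M_a$ and $N_b$ be image-finite LTSs and $k\in\mathbb N$. Then there are only finitely many homomorphisms from each finite tree of depth at most $k$ to $M_a$ and to $N_b$, and the following are equivalent: 1. for every finite tree $T_c$ of depth at most $k$, the number of homomorphisms from $T_c$ to $M_a$ equals the number of homomorphisms from $T_c$ to $N_b$; 2. $\mathtt{unr}^k(M_a)\cong\mathtt{unr}^k(N_b)$; 3. $M_a$ and $N_b$ satisfy the same formulas of graded modal logic of modal depth at most $k$. Moreover, if in each of $M$ and $N$ distinct actions are disjoint ($R_i\cap R_j=\emptyset$ for $i\ne j$), the same equivalence holds when in 2. the unraveling is replaced by the one that records only the visited states: its states are the strings $w=\langle w_1,\dots,w_n\rangle$ of states with $w_1=a$ in which each $w_{j+1}$ is a successor of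 $w_j$, its distinguished state is $\langle a\rangle$, $w$ satisfies $p$ iff $w_n\in p^M$, and $R_i(w,w')$ holds iff $w'$ is $w$ extended by one state $u$ with $R_i^M(w_n,u)$. -/

import Mathlib

universe u v w x y

/-- A labeled transition system over the modal signature with proposition letters `P` and
actions `R_i`, `i : I`: a structure with a set of states, one unary relation for each letter, one
binary relation for each action, and one distinguished state. -/
structure LTS (P : Type u) (I : Type v) where
  State : Type w
  root : State
  prop : P → State → Prop
  act : I → State → State → Prop

namespace LTS

variable {P : Type u} {I : Type v}

/-- The set of successors of a state along arbitrary actions. -/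
def succ (M : LTS.{u, v, w} P I) (m : M.State) : Set M.State :=
  {n | ∃ i, M.act i m n}

def ImageFinite (M : LTS.{u, v, w} P I) : Prop :=
  ∀ m, (M.succ m).Finite

/-- Distinct actions never share a transition. -/
def DisjointActions (M : LTS.{u, v, w} P I) : Prop :=
  ∀ i j m n, M.act i m n → M.act j m n → i = j

/-- Homomorphisms of pointed structures. -/
structure Hom (M : LTS.{u, v, w} P I) (N : LTS.{u, v, x} P I) where
  toFun : M.State → N.State
  map_root : toFun M.root = N.root
  map_prop : ∀ p m, M.prop p m → N.prop p (toFun m)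
  map_act : ∀ i m n, M.act i m n → N.act i (toFun m) (toFun n)

/-- The homomorphism count over the semiring of natural numbers. -/
noncomputable def homCount (M : LTS.{u, v, w} P I) (N : LTS.{u, v, x} P I) : ℕ :=
  Nat.card (Hom M N)

/-- Existence of an isomorphism of pointed structures: a bijection that preserves the distinguished
state and preserves and reflects all relations. -/
def Isomorphic (M : LTS.{u, v, w} P I) (N : LTS.{u, v, x} P I) : Prop :=
  ∃ e : M.State ≃ N.State, e M.root = N.root ∧
    (∀ p m, M.prop p m ↔ N.prop p (e m)) ∧
    (∀ i m n, M.act i m n ↔ N.act i (e m) (e n))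

/-- `M.IsPath m l n`: the facts `R_{i₁}(m, s₁), R_{i₂}(s₁, s₂), …` with
`l = [(i₁, s₁), (i₂, s₂), …]` form a directed path from `m` to `n`. Its length is `l.length`. -/
def IsPath (M : LTS.{u, v, w} P I) : M.State → List (I × M.State) → M.State → Prop
  | m, [], n => m = n
  | m, (i, s) :: l, n => M.act i m s ∧ M.IsPath s l n

/-- There is exactly one directed path from the root to each state. -/
def IsTree (M : LTS.{u, v, w} P I) : Prop :=
  ∀ m, ∃! l, M.IsPath M.root l m

/-- The length of a shortest directed path from the root (`⊤` if there is none). -/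
noncomputable def depthOf (M : LTS.{u, v, w} P I) (m : M.State) : ℕ∞ :=
  ⨅ (l : List (I × M.State)) (_ : M.IsPath M.root l m), (l.length : ℕ∞)

/-- The depth of a (point-generated) LTS: the supremum of the depths of its states. -/
noncomputable def depth (M : LTS.{u, v, w} P I) : ℕ∞ :=
  ⨆ m, M.depthOf m

/-- The class of finite trees of depth at most `k`. -/
def finiteTrees (P : Type u) (I : Type v) (k : ℕ) : Set (LTS.{u, v, w} P I) :=
  {T | Finite T.State ∧ T.IsTree ∧ T.depth ≤ k}

theorem depthOf_root (M : LTS.{u, v, w} P I) : M.depthOf M.root = 0 :=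
  le_antisymm
    (iInf₂_le (f := fun (l : List (I × M.State)) (_ : M.IsPath M.root l M.root) => (l.length : ℕ∞))
      [] rfl) bot_le

/-- The substructure of all states of depth at most `k`. -/
def truncate (M : LTS.{u, v, w} P I) (k : ℕ) : LTS.{u, v, w} P I where
  State := {m : M.State // M.depthOf m ≤ k}
  root := ⟨M.root, by rw [M.depthOf_root]; exact bot_le⟩
  prop p m := M.prop p m
  act i m n := M.act i m n

/-- The tree unraveling. Its states are the directed paths that start at the root, given as the
list of the actions taken and states visited, together with the last state. -/
def unravel (M : LTS.{u, v, w} P I) : LTS.{u, v, max v w} P I where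
  State := {q : List (I × M.State) × M.State // M.IsPath M.root q.1 q.2}
  root := ⟨([], M.root), rfl⟩
  prop p q := M.prop p q.1.2
  act i q r := M.act i q.1.2 r.1.2 ∧ r.1.1 = q.1.1 ++ [(i, r.1.2)]

/-- The unraveling whose states record only the states visited, not the actions taken: the nonempty
strings of states that start with the root and in which each state is a successor of the previous
one. -/
def stateUnravel (M : LTS.{u, v, w} P I) : LTS.{u, v, w} P I where
  State := {q : List M.State // q.head? = some M.root ∧ q.IsChain (fun m n => ∃ i, M.act i m n)}
  root := ⟨[M.root], rfl, List.IsChain.singleton _⟩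
  prop p q := ∃ m, q.1.getLast? = some m ∧ M.prop p m
  act i q r := ∃ m n, q.1.getLast? = some m ∧ M.act i m n ∧ r.1 = q.1 ++ [n]

end LTS

/-- Formulas of graded modal logic; `gdia n i φ` says that at least `n` many `R_i`-successors
satisfy `φ`. -/
inductive GML (P : Type u) (I : Type v) : Type (max u v)
  | top : GML P I
  | letter : P → GML P I
  | neg : GML P I → GML P I
  | and : GML P I → GML P I → GML P I
  | or : GML P I → GML P I → GML P I
  | dia : I → GML P I → GML P I
  | box : I → GML P I → GML P I
  | gdia : ℕ+ → I → GML P I → GML P I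

namespace GML

variable {P : Type u} {I : Type v}

def modalDepth : GML P I → ℕ
  | top => 0
  | letter _ => 0
  | neg φ => φ.modalDepth
  | and φ ψ => max φ.modalDepth ψ.modalDepth
  | or φ ψ => max φ.modalDepth ψ.modalDepth
  | dia _ φ => φ.modalDepth + 1
  | box _ φ => φ.modalDepth + 1
  | gdia _ _ φ => φ.modalDepth + 1

def Sat (M : LTS.{u, v, w} P I) : M.State → GML P I → Prop
  | _, top => True
  | m, letter p => M.prop p m
  | m, neg φ => ¬ Sat M m φ
  | m, and φ ψ => Sat M m φ ∧ Sat M m ψ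
  | m, or φ ψ => Sat M m φ ∨ Sat M m ψ
  | m, dia i φ => ∃ n, M.act i m n ∧ Sat M n φ
  | m, box i φ => ∀ n, M.act i m n → Sat M n φ
  | m, gdia c i φ => ((c : ℕ) : ℕ∞) ≤ Set.encard {n | M.act i m n ∧ Sat M n φ}

/-- Satisfaction of the same formulas of modal depth at most `k` at the distinguished states. -/
def EquivUpTo (k : ℕ) (M : LTS.{u, v, w} P I) (N : LTS.{u, v, x} P I) : Prop :=
  ∀ φ : GML P I, φ.modalDepth ≤ k → (Sat M M.root φ ↔ Sat N N.root φ)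

end GML

/-! All three conditions say that the two roots have the same graded bisimulation type of depth `k`
(`bisimType`): the letters that hold and, for each action, the multiset of depth `k - 1` types of
the successors. Image-finiteness keeps these multisets finite.

Formulas of modal depth at most `k` can be evaluated on types (`sat_bisimType`), and distinct types
are separated by such a formula (`exists_sat_not_sat`). If the types agree, successors can be
matched one to one with equal types; the matched pairs form an LTS that covers both systems down to
depth `k`, and a covering does not change the truncated unraveling (`isomorphic_of_bisimType_eq`).
Isomorphic unravelings give equal counts because a homomorphism from a tree lifts uniquely to the
unraveling (`IsTree.bijective_comp_lastHom`).

The step from counts to types is the algebraic one. The count of a tree at a state depends only on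
the type of the state: it is a product over the subtrees of sums over successors (`homCount_node`).
Gluing trees at their roots multiplies counts, so the counts form a family of functions on types
that contains `1` and is closed under products. By induction on the depth it separates types, and by
interpolation its sums then determine the multisets of successor types (`Multiset.eq_of_sum_map_eq`,
`TreeShape.eq_of_count_eq`). -/

/-- A family of `ℕ`-valued functions that contains `1`, is closed under products and separates
points determines a finite multiset by the sums of its members. -/
theorem Multiset.eq_of_sum_map_eq {α ι : Type*} (h : ι → α → ℕ)
    (one : ∃ j, ∀ a, h j a = 1) (mul : ∀ j l, ∃ r, ∀ a, h r a = h j a * h l a)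
    (sep : ∀ a b, (∀ j, h j a = h j b) → a = b) (S S' : Multiset α)
    (hS : ∀ j, (S.map (h j)).sum = (S'.map (h j)).sum) : S = S' := by
  classical
  -- Sums agree for every product of linear factors `h q.1 - q.2`. The spare factor `h j` absorbs
  -- each expanded `h q.1`, by closure under products. The values are integers so that one may
  -- subtract.
  have sum_eq : ∀ (U : Finset (ι × ℤ)) (j : ι),
      (S.map fun a => (∏ q ∈ U, ((h q.1 a : ℤ) - q.2)) * h j a).sum =
        (S'.map fun a => (∏ q ∈ U, ((h q.1 a : ℤ) - q.2)) * h j a).sum := by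
    intro U
    induction U using Finset.induction_on with
    | empty =>
      intro j
      have := congrArg (Nat.cast : ℕ → ℤ) (hS j)
      simpa [Nat.cast_multiset_sum, Multiset.map_map, Function.comp_def] using this
    | insert q U hq ih =>
      intro j
      obtain ⟨r, hr⟩ := mul q.1 j
      have expand : ∀ a, (∏ q ∈ insert q U, ((h q.1 a : ℤ) - q.2)) * h j a =
          (∏ q ∈ U, ((h q.1 a : ℤ) - q.2)) * h r a -
            q.2 * ((∏ q ∈ U, ((h q.1 a : ℤ) - q.2)) * h j a) := by
        intro a
        rw [Finset.prod_insert hq, hr]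
        push_cast
        ring
      simp only [expand, Multiset.sum_map_sub, Multiset.sum_map_mul_left, ih]
  ext a
  have ex : ∀ b, ∃ j, b ≠ a → h j b ≠ h j a := by
    intro b
    by_cases hb : b = a
    · exact ⟨one.choose, fun h => absurd hb h⟩
    · by_contra! hcon
      exact hb (sep b a fun j => (hcon j).2)
  choose c hc using ex
  obtain ⟨o, ho⟩ := one
  let V := (S + S').toFinset.erase a
  -- Interpolation: the product `p` of these factors vanishes at every element of `S + S'` other
  -- than `a`, but not at `a`. Summing it isolates the multiplicity of `a`.
  let U : Finset (ι × ℤ) := V.image fun b => (c b, (h (c b) b : ℤ))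
  let p : α → ℤ := fun b => ∏ q ∈ U, ((h q.1 b : ℤ) - q.2)
  have pa : p a ≠ 0 := by
    refine Finset.prod_ne_zero_iff.2 fun q hq => ?_
    obtain ⟨b, hb, rfl⟩ := Finset.mem_image.1 hq
    have := hc b (Finset.ne_of_mem_erase hb)
    simp only [ne_eq, sub_eq_zero, Nat.cast_inj]
    exact fun e => this e.symm
  have pb : ∀ b ∈ S + S', b ≠ a → p b = 0 := by
    intro b hb hba
    refine Finset.prod_eq_zero (i := (c b, (h (c b) b : ℤ))) ?_ (sub_self _)
    exact Finset.mem_image_of_mem _ (Finset.mem_erase.2 ⟨hba, Multiset.mem_toFinset.2 hb⟩)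
  have sum_p : ∀ R : Multiset α, R ≤ S + S' → (R.map p).sum = R.count a * p a := by
    intro R hR
    rw [Multiset.map_congr (g := fun b => if b = a then p a else 0) rfl]
    · clear hR
      induction R using Multiset.induction_on with
      | empty => simp
      | cons b R ih =>
        rw [Multiset.map_cons, Multiset.sum_cons, ih, Multiset.count_cons]
        by_cases hb : b = a
        · simp [hb]; ring
        · simp [hb, Ne.symm hb]
    · intro b hb
      split_ifs with hba
      · rw [hba]
      · exact pb b (Multiset.mem_of_le hR hb) hba
  have key := sum_eq U o
  simp only [ho, Nat.cast_one, mul_one] at key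
  change (S.map p).sum = (S'.map p).sum at key
  rw [sum_p S (Multiset.le_add_right _ _), sum_p S' (Multiset.le_add_left _ _)] at key
  exact_mod_cast mul_right_cancel₀ pa key

/-- Pulls a multiset of successor types back to actual successors, so that graded modalities on
types can be compared with cardinalities of sets of states. -/
theorem Multiset.exists_le_map_eq_of_le_map {α β : Type*} {f : α → β} {S : Multiset β}
    {T : Multiset α} (h : S ≤ T.map f) : ∃ S' ≤ T, S'.map f = S := by
  induction S using Quotient.inductionOn with | _ l
  induction T using Quotient.inductionOn with | _ l'
  obtain ⟨r, hr, hsub⟩ := h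
  obtain ⟨r', hr', rfl⟩ := List.sublist_map_iff.1 hsub
  exact ⟨r', hr'.subperm, Multiset.coe_eq_coe.2 hr⟩

/-! ### Graded bisimulation types and their separation by formulas -/

/-- Graded bisimulation types of depth `k`: the letters that hold, and, for positive depth, for each
action the multiset of the types of the successors. -/
def BisimType (P : Type u) (I : Type v) : ℕ → Type (max u v)
  | 0 => ULift.{v} (Set P)
  | k + 1 => Set P × (I → Multiset (BisimType P I k))

namespace BisimType

variable {P : Type u} {I : Type v}

def letters : {k : ℕ} → BisimType P I k → Set P
  | 0, t => t.down
  | _ + 1, t => t.1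

def children {k : ℕ} (t : BisimType P I (k + 1)) : I → Multiset (BisimType P I k) := t.2

theorem ext_zero {s t : BisimType P I 0} (h : s.letters = t.letters) : s = t :=
  ULift.ext _ _ h

theorem ext_succ {k : ℕ} {s t : BisimType P I (k + 1)} (h : s.letters = t.letters)
    (hc : ∀ i, s.children i = t.children i) : s = t :=
  Prod.ext h (funext hc)

/-- Satisfaction of a formula at a type; meaningful for modal depth at most `k`. -/
def Sat : GML P I → {k : ℕ} → BisimType P I k → Prop
  | .top, _, _ => True
  | .letter p, _, t => p ∈ t.letters
  | .neg φ, _, t => ¬ Sat φ t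
  | .and φ ψ, _, t => Sat φ t ∧ Sat ψ t
  | .or φ ψ, _, t => Sat φ t ∨ Sat ψ t
  | .dia _ _, 0, _ => False
  | .box _ _, 0, _ => False
  | .gdia _ _ _, 0, _ => False
  | .dia i φ, _ + 1, t => ∃ s ∈ t.children i, Sat φ s
  | .box i φ, _ + 1, t => ∀ s ∈ t.children i, Sat φ s
  | .gdia c i φ, _ + 1, t => ∃ S ≤ t.children i, (c : ℕ) ≤ S.card ∧ ∀ s ∈ S, Sat φ s

/-- The conjunction of the separating formulas over the finite multiset `U` isolates `s` within `U`.
No formula isolating `s` among all types is needed. -/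
theorem exists_sat_and_forall_not_sat {k : ℕ}
    (sep : ∀ s t : BisimType P I k, s ≠ t → ∃ φ : GML P I, φ.modalDepth ≤ k ∧ Sat φ s ∧ ¬ Sat φ t)
    (s : BisimType P I k) (U : Multiset (BisimType P I k)) :
    ∃ φ : GML P I, φ.modalDepth ≤ k ∧ Sat φ s ∧ ∀ t ∈ U, t ≠ s → ¬ Sat φ t := by
  induction U using Multiset.induction_on with
  | empty => exact ⟨.top, Nat.zero_le _, by simp [Sat], by simp⟩
  | cons t U ih =>
    obtain ⟨φ, hφ, hs, hU⟩ := ih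
    by_cases h : s = t
    · refine ⟨φ, hφ, hs, fun r hr hrs => ?_⟩
      rcases Multiset.mem_cons.1 hr with rfl | hr
      · exact absurd h.symm hrs
      · exact hU r hr hrs
    · obtain ⟨ψ, hψ, hs', ht⟩ := sep s t h
      refine ⟨.and φ ψ, max_le hφ hψ, by simp [Sat, hs, hs'], fun r hr hrs => ?_⟩
      simp only [Sat]
      rcases Multiset.mem_cons.1 hr with rfl | hr
      · exact fun h => ht h.2
      · exact fun h => hU r hr hrs h.1

-- With `φ` isolating `r` among the children of `t`, the grade is the multiplicity of `r` in `s`.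
-- Further children of `s` that satisfy `φ` do no harm, while in `t` only copies of `r` count, and
-- there are too few.
open Classical in
theorem exists_sat_of_count_lt {k : ℕ}
    (sep : ∀ s t : BisimType P I k, s ≠ t → ∃ φ : GML P I, φ.modalDepth ≤ k ∧ Sat φ s ∧ ¬ Sat φ t)
    (s t : BisimType P I (k + 1)) (i : I) (r : BisimType P I k)
    (h : (t.children i).count r < (s.children i).count r) :
    ∃ φ : GML P I, φ.modalDepth ≤ k + 1 ∧ Sat φ s ∧ ¬ Sat φ t := by
  obtain ⟨φ, hφ, hr, hU⟩ := exists_sat_and_forall_not_sat sep r (t.children i)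
  refine ⟨.gdia ⟨(s.children i).count r, Nat.zero_lt_of_lt h⟩ i φ, Nat.succ_le_succ hφ, ?_, ?_⟩
  · refine ⟨Multiset.replicate ((s.children i).count r) r, ?_, ?_, ?_⟩
    · exact Multiset.le_count_iff_replicate_le.1 le_rfl
    · simp
    · intro q hq
      rwa [Multiset.eq_of_mem_replicate hq]
  · rintro ⟨S, hS, hc, hall⟩
    have : S = Multiset.replicate S.card r := by
      refine Multiset.eq_replicate_card.2 fun q hq => ?_
      by_contra hne
      exact hU q (Multiset.mem_of_le hS hq) hne (hall q hq)
    rw [this] at hS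
    have := Multiset.le_count_iff_replicate_le.2 hS
    exact absurd (hc.trans this) (not_le.2 h)

theorem exists_sat_not_sat_of_letters_ne {k : ℕ} {s t : BisimType P I k}
    (h : s.letters ≠ t.letters) :
    ∃ φ : GML P I, φ.modalDepth ≤ k ∧ Sat φ s ∧ ¬ Sat φ t := by
  obtain ⟨p, hp⟩ : ∃ p, ¬ (p ∈ s.letters ↔ p ∈ t.letters) := by
    by_contra! hcon
    exact h (Set.ext hcon)
  by_cases hs : p ∈ s.letters
  · exact ⟨.letter p, Nat.zero_le _, by simpa [Sat], by simp only [Sat]; tauto⟩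
  · exact ⟨.neg (.letter p), Nat.zero_le _, by simpa [Sat], by simp only [Sat]; tauto⟩

theorem exists_sat_not_sat {k : ℕ} : ∀ s t : BisimType P I k, s ≠ t →
    ∃ φ : GML P I, φ.modalDepth ≤ k ∧ Sat φ s ∧ ¬ Sat φ t := by
  classical
  induction k with
  | zero => exact fun s t h => exists_sat_not_sat_of_letters_ne fun hl => h (ext_zero hl)
  | succ k ih =>
    intro s t h
    by_cases hl : s.letters = t.letters
    · obtain ⟨i, hi⟩ : ∃ i, s.children i ≠ t.children i := by
        by_contra! hcon
        exact h (ext_succ hl hcon)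
      obtain ⟨r, hr⟩ : ∃ r, (s.children i).count r ≠ (t.children i).count r := by
        by_contra! hcon
        exact hi (Multiset.ext.2 hcon)
      rcases lt_or_gt_of_ne hr with hlt | hgt
      · obtain ⟨φ, hφ, ht, hs⟩ := exists_sat_of_count_lt ih t s i r hlt
        exact ⟨.neg φ, hφ, hs, by simpa [Sat] using ht⟩
      · exact exists_sat_of_count_lt ih s t i r hgt
    · exact exists_sat_not_sat_of_letters_ne hl

end BisimType

/-! ### Types of states and satisfaction of formulas -/

namespace LTS

variable {P : Type u} {I : Type v}

theorem ImageFinite.finite_act {M : LTS.{u, v, w} P I} (hM : M.ImageFinite) (i : I)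
    (m : M.State) : {n | M.act i m n}.Finite :=
  (hM m).subset fun _ hn => ⟨i, hn⟩

/-- The graded bisimulation type of depth `k` of a state. -/
noncomputable def bisimType {M : LTS.{u, v, w} P I} (hM : M.ImageFinite) :
    (k : ℕ) → M.State → BisimType P I k
  | 0, m => ⟨{p | M.prop p m}⟩
  | k + 1, m => ({p | M.prop p m},
      fun i => (hM.finite_act i m).toFinset.val.map (bisimType hM k))

theorem letters_bisimType {M : LTS.{u, v, w} P I} (hM : M.ImageFinite) (k : ℕ) (m : M.State) :
    (bisimType hM k m).letters = {p | M.prop p m} := by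
  cases k <;> rfl

theorem children_bisimType {M : LTS.{u, v, w} P I} (hM : M.ImageFinite) (k : ℕ) (m : M.State)
    (i : I) : (bisimType hM (k + 1) m).children i =
      (hM.finite_act i m).toFinset.val.map (bisimType hM k) := rfl

/-- Each modality moves to the successors and uses up one level of the type; children are kept with
multiplicity, so grades can be read off. -/
theorem sat_bisimType {M : LTS.{u, v, w} P I} (hM : M.ImageFinite) (φ : GML P I) :
    ∀ (k : ℕ) (m : M.State), φ.modalDepth ≤ k →
      (BisimType.Sat φ (bisimType hM k m) ↔ GML.Sat M m φ) := by
  induction φ with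
  | top => intro k m _; simp [BisimType.Sat, GML.Sat]
  | letter p => intro k m _; simp [BisimType.Sat, GML.Sat, letters_bisimType]
  | neg φ ih => intro k m h; simp only [BisimType.Sat, GML.Sat, ih k m h]
  | and φ ψ ih ih' =>
    intro k m h
    simp only [BisimType.Sat, GML.Sat, ih k m ((le_max_left _ _).trans h),
      ih' k m ((le_max_right _ _).trans h)]
  | or φ ψ ih ih' =>
    intro k m h
    simp only [BisimType.Sat, GML.Sat, ih k m ((le_max_left _ _).trans h),
      ih' k m ((le_max_right _ _).trans h)]
  | dia i φ ih =>
    rintro (_ | k) m h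
    · simp [GML.modalDepth] at h
    · have ih := fun n => ih k n (Nat.le_of_succ_le_succ h)
      simp [BisimType.Sat, GML.Sat, children_bisimType, ih]
  | box i φ ih =>
    rintro (_ | k) m h
    · simp [GML.modalDepth] at h
    · have ih := fun n => ih k n (Nat.le_of_succ_le_succ h)
      simp [BisimType.Sat, GML.Sat, children_bisimType, ih]
  | gdia c i φ ih =>
    classical
    rintro (_ | k) m h
    · simp [GML.modalDepth] at h
    · have ih := fun n => ih k n (Nat.le_of_succ_le_succ h)
      simp only [BisimType.Sat, GML.Sat, children_bisimType]
      set F := (hM.finite_act i m).toFinset with hF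
      have hset : {n | M.act i m n ∧ GML.Sat M n φ} = ↑(F.filter fun n => GML.Sat M n φ) := by
        ext n; simp [hF]
      rw [hset, Set.encard_coe_eq_coe_finsetCard, Nat.cast_le]
      constructor
      · rintro ⟨S, hS, hc, hall⟩
        obtain ⟨S', hS', rfl⟩ : ∃ S' ≤ F.val, S'.map (bisimType hM k) = S :=
          Multiset.exists_le_map_eq_of_le_map hS
        refine hc.trans ?_
        rw [Multiset.card_map, Finset.card_def, Finset.filter_val]
        refine Multiset.card_le_card (Multiset.le_filter.2 ⟨hS', fun n hn => ?_⟩)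
        exact (ih n).1 (hall _ (Multiset.mem_map_of_mem _ hn))
      · intro hc
        refine ⟨(F.filter fun n => GML.Sat M n φ).val.map (bisimType hM k),
          Multiset.map_le_map (Multiset.filter_le _ _),
          by rwa [Multiset.card_map], ?_⟩
        intro s hs
        obtain ⟨n, hn, rfl⟩ := Multiset.mem_map.1 hs
        exact (ih n).2 (Finset.mem_filter.1 hn).2

theorem equivUpTo_iff_bisimType_eq {M : LTS.{u, v, w} P I} {N : LTS.{u, v, x} P I}
    (hM : M.ImageFinite) (hN : N.ImageFinite) (k : ℕ) :
    GML.EquivUpTo k M N ↔ bisimType hM k M.root = bisimType hN k N.root := by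
  constructor
  · intro h
    by_contra hne
    obtain ⟨φ, hφ, hs, ht⟩ := BisimType.exists_sat_not_sat _ _ hne
    exact ht ((sat_bisimType hN φ k _ hφ).2 ((h φ hφ).1 ((sat_bisimType hM φ k _ hφ).1 hs)))
  · intro h φ hφ
    rw [← sat_bisimType hM φ k _ hφ, ← sat_bisimType hN φ k _ hφ, h]

end LTS

/-! ### Paths, homomorphisms and isomorphisms -/

namespace LTS

variable {P : Type u} {I : Type v}

theorem isPath_append (M : LTS.{u, v, w} P I) {l l' : List (I × M.State)} {m n : M.State} :
    M.IsPath m (l ++ l') n ↔ ∃ s, M.IsPath m l s ∧ M.IsPath s l' n := by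
  induction l generalizing m with
  | nil => simp [IsPath]
  | cons a l ih =>
    obtain ⟨i, s⟩ := a
    simp only [List.cons_append, IsPath, ih]
    tauto

theorem isPath_concat (M : LTS.{u, v, w} P I) {l : List (I × M.State)} {i : I}
    {m n t : M.State} :
    M.IsPath m (l ++ [(i, t)]) n ↔ ∃ s, M.IsPath m l s ∧ M.act i s t ∧ t = n := by
  simp [isPath_append, IsPath]

theorem IsPath.unique {M : LTS.{u, v, w} P I} {l : List (I × M.State)} {m n n' : M.State}
    (h : M.IsPath m l n) (h' : M.IsPath m l n') : n = n' := by
  induction l generalizing m with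
  | nil => exact Eq.trans (Eq.symm h) h'
  | cons a l ih => exact ih h.2 h'.2

/-- The list of facts that a map of states makes out of a list of facts. -/
def mapPath {S : Type w} {S' : Type x} (f : S → S') (l : List (I × S)) : List (I × S') :=
  l.map (Prod.map id f)

theorem length_mapPath {S : Type w} {S' : Type x} (f : S → S') (l : List (I × S)) :
    (mapPath f l).length = l.length := List.length_map _

theorem mapPath_concat {S : Type w} {S' : Type x} (f : S → S') (l : List (I × S)) (i : I) (s : S) :
    mapPath f (l ++ [(i, s)]) = mapPath f l ++ [(i, f s)] := by
  simp [mapPath]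

theorem IsPath.map {M : LTS.{u, v, w} P I} {N : LTS.{u, v, x} P I} {f : M.State → N.State}
    (hf : ∀ i m n, M.act i m n → N.act i (f m) (f n)) {l : List (I × M.State)} {m n : M.State}
    (h : M.IsPath m l n) : N.IsPath (f m) (mapPath f l) (f n) := by
  induction l generalizing m with
  | nil => exact congrArg f h
  | cons a l ih => exact ⟨hf _ _ _ h.1, ih h.2⟩

theorem depthOf_le_of_isPath {M : LTS.{u, v, w} P I} {l : List (I × M.State)} {m : M.State}
    (h : M.IsPath M.root l m) : M.depthOf m ≤ l.length :=
  iInf₂_le (f := fun (l : List (I × M.State)) (_ : M.IsPath M.root l m) => (l.length : ℕ∞)) l h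

theorem IsTree.depthOf_eq {M : LTS.{u, v, w} P I} (hM : M.IsTree) {l : List (I × M.State)}
    {m : M.State} (h : M.IsPath M.root l m) : M.depthOf m = l.length := by
  refine le_antisymm (depthOf_le_of_isPath h) (le_iInf₂ fun l' h' => ?_)
  rw [(hM m).unique h h']

theorem Hom.depthOf_le {M : LTS.{u, v, w} P I} {N : LTS.{u, v, x} P I} (f : Hom M N)
    (m : M.State) : N.depthOf (f.toFun m) ≤ M.depthOf m := by
  refine le_iInf₂ fun l h => ?_
  have := h.map f.map_act
  rw [f.map_root] at this
  simpa [length_mapPath] using depthOf_le_of_isPath this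

@[ext]
theorem Hom.ext {M : LTS.{u, v, w} P I} {N : LTS.{u, v, x} P I} {f g : Hom M N}
    (h : ∀ m, f.toFun m = g.toFun m) : f = g := by
  cases f; cases g
  congr
  exact funext h

def Hom.comp {L : LTS.{u, v, y} P I} {M : LTS.{u, v, w} P I} {N : LTS.{u, v, x} P I}
    (g : Hom M N) (f : Hom L M) : Hom L N where
  toFun m := g.toFun (f.toFun m)
  map_root := by rw [f.map_root, g.map_root]
  map_prop p m h := g.map_prop _ _ (f.map_prop _ _ h)
  map_act i m n h := g.map_act _ _ _ (f.map_act _ _ _ h)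

theorem Isomorphic.symm {M : LTS.{u, v, w} P I} {N : LTS.{u, v, x} P I} (h : Isomorphic M N) :
    Isomorphic N M := by
  obtain ⟨e, hr, hp, ha⟩ := h
  exact ⟨e.symm, by rw [← hr, e.symm_apply_apply], fun p m => by simp [hp],
    fun i m n => by simp [ha]⟩

theorem Isomorphic.trans {L : LTS.{u, v, y} P I} {M : LTS.{u, v, w} P I} {N : LTS.{u, v, x} P I}
    (h : Isomorphic L M) (h' : Isomorphic M N) : Isomorphic L N := by
  obtain ⟨e, hr, hp, ha⟩ := h
  obtain ⟨e', hr', hp', ha'⟩ := h'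
  exact ⟨e.trans e', by simp [hr, hr'], fun p m => by simp [hp, hp'],
    fun i m n => by simp [ha, ha']⟩

theorem Isomorphic.homCount_eq {M : LTS.{u, v, w} P I} {N : LTS.{u, v, x} P I}
    (h : Isomorphic M N) (T : LTS.{u, v, y} P I) : homCount T M = homCount T N := by
  obtain ⟨e, hr, hp, ha⟩ := h
  let f : Hom M N := ⟨e, hr, fun p m => (hp p m).1, fun i m n => (ha i m n).1⟩
  let g : Hom N M := ⟨e.symm, by rw [← hr, e.symm_apply_apply], fun p m => by simp [hp],
    fun i m n => by simp [ha]⟩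
  exact Nat.card_congr ⟨f.comp, g.comp, fun t => Hom.ext fun _ => e.symm_apply_apply _,
    fun t => Hom.ext fun _ => e.apply_symm_apply _⟩

theorem Isomorphic.truncate {M : LTS.{u, v, w} P I} {N : LTS.{u, v, x} P I}
    (h : Isomorphic M N) (k : ℕ) : Isomorphic (M.truncate k) (N.truncate k) := by
  obtain ⟨e, hr, hp, ha⟩ := h
  let f : Hom M N := ⟨e, hr, fun p m => (hp p m).1, fun i m n => (ha i m n).1⟩
  let g : Hom N M := ⟨e.symm, by rw [← hr, e.symm_apply_apply], fun p m => by simp [hp],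
    fun i m n => by simp [ha]⟩
  have depth_eq : ∀ m, M.depthOf m = N.depthOf (e m) := fun m =>
    le_antisymm (by simpa [g] using g.depthOf_le (e m)) (f.depthOf_le m)
  exact ⟨e.subtypeEquiv fun m => by rw [depth_eq], Subtype.ext hr, fun p m => hp p m.1,
    fun i m n => ha i m.1 n.1⟩

/-! ### Finiteness of the set of homomorphisms from a finite tree -/

theorem ImageFinite.finite_isPath {M : LTS.{u, v, w} P I} (hM : M.ImageFinite) (r : ℕ) :
    ∀ m, {n | ∃ l, l.length = r ∧ M.IsPath m l n}.Finite := by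
  induction r with
  | zero =>
    intro m
    refine (Set.finite_singleton m).subset ?_
    rintro n ⟨l, hl, h⟩
    rw [List.length_eq_zero_iff] at hl
    subst hl
    exact Eq.symm h
  | succ r ih =>
    intro m
    refine ((hM m).biUnion fun s _ => ih s).subset ?_
    rintro n ⟨_ | ⟨⟨i, s⟩, l⟩, hl, h⟩
    · simp at hl
    · exact Set.mem_biUnion (x := s) ⟨i, h.1⟩ ⟨l, by simpa using hl, h.2⟩

/-- A homomorphism sends `t` to the end of a path from the root as long as the path to `t`, and
image-finiteness leaves finitely many such ends. -/
theorem IsTree.finite_hom {T : LTS.{u, v, y} P I} (hT : T.IsTree) [Finite T.State]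
    {M : LTS.{u, v, w} P I} (hM : M.ImageFinite) : Finite (Hom T M) := by
  choose l hl using fun t => (hT t).exists
  let S : T.State → Set M.State := fun t => 
    {n | ∃ l', l'.length = (l t).length ∧ M.IsPath M.root l' n}
  have : ∀ t, Finite (S t) := fun t => hM.finite_isPath _ _
  refine Finite.of_injective (β := ∀ t, S t) (fun f t => ⟨f.toFun t, mapPath f.toFun (l t),
    length_mapPath _ _, ?_⟩) ?_
  · have := (hl t).map f.map_act
    rwa [f.map_root] at this
  · intro f g h
    exact Hom.ext fun t => congrArg Subtype.val (congrFun h t)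

/-! ### The unraveling -/

theorem length_of_isPath_unravel {M : LTS.{u, v, w} P I} {l : List (I × M.unravel.State)}
    {q r : M.unravel.State} (h : M.unravel.IsPath q l r) :
    r.1.1.length = q.1.1.length + l.length := by
  induction l generalizing q with
  | nil => cases h; rfl
  | cons a l ih =>
    obtain ⟨i, s⟩ := a
    rw [ih h.2, h.1.2]
    simp
    omega

theorem exists_isPath_unravel {M : LTS.{u, v, w} P I} (l : List (I × M.State)) (m : M.State)
    (h : M.IsPath M.root l m) : ∃ l', M.unravel.IsPath M.unravel.root l' ⟨(l, m), h⟩ := by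
  induction l using List.reverseRecOn generalizing m with
  | nil => cases h; exact ⟨[], rfl⟩
  | append_singleton l a ih =>
    obtain ⟨i, t⟩ := a
    obtain ⟨s, hs, hact, rfl⟩ := M.isPath_concat.1 h
    obtain ⟨l', hl'⟩ := ih s hs
    exact ⟨l' ++ [(i, ⟨(_, t), h⟩)], (isPath_concat _).2 ⟨_, hl', ⟨hact, rfl⟩, rfl⟩⟩

/-- Every transition lengthens the recorded path by exactly one, so all directed paths from the root
to `q` have the same length. -/
theorem depthOf_unravel {M : LTS.{u, v, w} P I} (q : M.unravel.State) :
    M.unravel.depthOf q = q.1.1.length := by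
  have len : ∀ l, M.unravel.IsPath M.unravel.root l q → q.1.1.length = l.length := by
    intro l h
    have := length_of_isPath_unravel h
    simpa [unravel] using this
  obtain ⟨l, hl⟩ := exists_isPath_unravel q.1.1 q.1.2 q.2
  refine le_antisymm ((depthOf_le_of_isPath hl).trans (by rw [len l hl])) ?_
  exact le_iInf₂ fun l h => by rw [len l h]

theorem depthOf_unravel_le_iff {M : LTS.{u, v, w} P I} (q : M.unravel.State) {k : ℕ} :
    M.unravel.depthOf q ≤ k ↔ q.1.1.length ≤ k := by
  rw [depthOf_unravel, Nat.cast_le]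

/-- The projection of the truncated unraveling to the last states. -/
def lastHom (M : LTS.{u, v, w} P I) (k : ℕ) : Hom (M.unravel.truncate k) M where
  toFun q := q.1.1.2
  map_root := rfl
  map_prop _ _ h := h
  map_act _ _ _ h := h.1

/-- A state of the unraveling records its own history, so a homomorphism into it is determined, at
reachable states, by its projection to last states. -/
theorem Hom.path_eq {T : LTS.{u, v, y} P I} {M : LTS.{u, v, w} P I} {k : ℕ}
    (f : Hom T (M.unravel.truncate k)) (l : List (I × T.State)) (t : T.State)
    (h : T.IsPath T.root l t) :
    (f.toFun t).1.1.1 = mapPath ((M.lastHom k).comp f).toFun l := by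
  induction l using List.reverseRecOn generalizing t with
  | nil => cases h; rw [f.map_root]; rfl
  | append_singleton l a ih =>
    obtain ⟨i, t⟩ := a
    obtain ⟨s, hs, hact, rfl⟩ := T.isPath_concat.1 h
    rw [mapPath_concat, ← ih s hs]
    exact (f.map_act _ _ _ hact).2

/-- The lift of `f` sends `t` to the image under `f` of the unique path to `t`; the depth bound on
`T` keeps it within the truncation. -/
theorem IsTree.bijective_comp_lastHom {T : LTS.{u, v, y} P I} (hT : T.IsTree)
    (M : LTS.{u, v, w} P I) {k : ℕ} (hk : T.depth ≤ k) :
    Function.Bijective ((M.lastHom k).comp : Hom T (M.unravel.truncate k) → Hom T M) := by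
  choose l hl using fun t => (hT t).exists
  constructor
  · intro f g h
    refine Hom.ext fun t => Subtype.ext (Subtype.ext (Prod.ext ?_ ?_))
    · rw [f.path_eq _ t (hl t), g.path_eq _ t (hl t), h]
    · exact congrFun (congrArg Hom.toFun h) t
  · intro f
    have path : ∀ t, M.IsPath M.root (mapPath f.toFun (l t)) (f.toFun t) := fun t => by
      have := (hl t).map f.map_act
      rwa [f.map_root] at this
    refine ⟨⟨fun t => ⟨⟨(mapPath f.toFun (l t), f.toFun t), path t⟩, ?_⟩, ?_, ?_, ?_⟩, rfl⟩
    · refine (depthOf_unravel_le_iff _).2 ((length_mapPath _ _).trans_le ?_)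
      rw [← Nat.cast_le (α := ℕ∞), ← hT.depthOf_eq (hl t)]
      exact (le_iSup T.depthOf t).trans hk
    · refine Subtype.ext (Subtype.ext (Prod.ext ?_ f.map_root))
      have : l T.root = [] := (hT T.root).unique (hl _) rfl
      simp only [this]
      rfl
    · exact fun p m h => f.map_prop p m h
    · intro i s t h
      refine ⟨f.map_act _ _ _ h, ?_⟩
      have : l t = l s ++ [(i, t)] :=
        (hT t).unique (hl t) (T.isPath_concat.2 ⟨s, hl s, h, rfl⟩)
      simp only [this, mapPath_concat]

theorem IsTree.homCount_unravel {T : LTS.{u, v, y} P I} (hT : T.IsTree)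
    (M : LTS.{u, v, w} P I) {k : ℕ} (hk : T.depth ≤ k) :
    homCount T (M.unravel.truncate k) = homCount T M :=
  Nat.card_congr (Equiv.ofBijective _ (hT.bijective_comp_lastHom M hk))

/-! ### Unravelings of coverings -/

/-- A map that preserves and reflects letters and, down to `k` steps from the root, maps the
`i`-successors of a state bijectively to the `i`-successors of its image. -/
structure CoversUpTo (k : ℕ) (Z : LTS.{u, v, w} P I) (M : LTS.{u, v, x} P I)
    (f : Z.State → M.State) where
  level : Z.State → ℕ
  level_root : level Z.root = k
  level_act : ∀ i z z', Z.act i z z' → level z = level z' + 1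
  map_root : f Z.root = M.root
  prop_iff : ∀ p z, Z.prop p z ↔ M.prop p (f z)
  map_act : ∀ i z z', Z.act i z z' → M.act i (f z) (f z')
  inj : ∀ i z z₁ z₂, Z.act i z z₁ → Z.act i z z₂ → f z₁ = f z₂ → z₁ = z₂
  surj : ∀ i z n, 0 < level z → M.act i (f z) n → ∃ z', Z.act i z z' ∧ f z' = n

theorem CoversUpTo.lift_unique {k : ℕ} {Z : LTS.{u, v, w} P I} {M : LTS.{u, v, x} P I}
    {f : Z.State → M.State} (c : CoversUpTo k Z M f) {l l' : List (I × Z.State)}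
    {z n n' : Z.State} (h : Z.IsPath z l n) (h' : Z.IsPath z l' n')
    (e : mapPath f l = mapPath f l') : l = l' := by
  induction l generalizing z l' with
  | nil => exact (List.map_eq_nil_iff.1 e.symm).symm
  | cons a l ih =>
    cases l' with
    | nil => simp [mapPath] at e
    | cons b l' =>
      obtain ⟨i, s⟩ := a
      obtain ⟨j, t⟩ := b
      simp only [mapPath, List.map_cons, List.cons.injEq, Prod.map_apply, id, Prod.mk.injEq] at e
      obtain ⟨⟨rfl, hst⟩, e⟩ := e
      obtain rfl := c.inj _ _ _ _ h.1 h'.1 hst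
      rw [ih h.2 h'.2 e]

/-- `level` is the number of steps still available. It drops by one per transition, so it stays
positive as long as facts of `l` remain to be lifted. -/
theorem CoversUpTo.exists_lift {k : ℕ} {Z : LTS.{u, v, w} P I} {M : LTS.{u, v, x} P I}
    {f : Z.State → M.State} (c : CoversUpTo k Z M f) {l : List (I × M.State)} {n : M.State}
    (z : Z.State) (hl : l.length ≤ c.level z) (h : M.IsPath (f z) l n) :
    ∃ l' n', Z.IsPath z l' n' ∧ mapPath f l' = l ∧ f n' = n := by
  induction l generalizing z with
  | nil => exact ⟨[], z, rfl, rfl, h⟩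
  | cons a l ih =>
    obtain ⟨i, s⟩ := a
    rw [List.length_cons] at hl
    obtain ⟨z', hz', rfl⟩ := c.surj i z s (by omega) h.1
    have := c.level_act _ _ _ hz'
    obtain ⟨l', n', hp, rfl, rfl⟩ := ih z' (by omega) h.2
    exact ⟨(i, z') :: l', n', ⟨hz', hp⟩, rfl, rfl⟩

/-- Unique path lifting: down to length `k`, paths from the two roots correspond bijectively. -/
theorem CoversUpTo.isomorphic {k : ℕ} {Z : LTS.{u, v, w} P I} {M : LTS.{u, v, x} P I}
    {f : Z.State → M.State} (c : CoversUpTo k Z M f) :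
    Isomorphic (Z.unravel.truncate k) (M.unravel.truncate k) := by
  have path : ∀ q : Z.unravel.State, M.IsPath M.root (mapPath f q.1.1) (f q.1.2) := fun q => by
    have := q.2.map c.map_act
    rwa [c.map_root] at this
  let F : (Z.unravel.truncate k).State → (M.unravel.truncate k).State := fun q =>
    ⟨⟨(mapPath f q.1.1.1, f q.1.1.2), path q.1⟩,
      (depthOf_unravel_le_iff _).2
        ((length_mapPath _ _).trans_le ((depthOf_unravel_le_iff q.1).1 q.2))⟩
  have inj : Function.Injective F := by
    intro q r h
    have h1 : q.1.1.1 = r.1.1.1 := c.lift_unique q.1.2 r.1.2 (congrArg (fun s => s.1.1.1) h)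
    refine Subtype.ext (Subtype.ext (Prod.ext h1 ?_))
    have := q.1.2
    rw [h1] at this
    exact this.unique r.1.2
  have surj : Function.Surjective F := by
    rintro ⟨⟨⟨l, n⟩, h⟩, hk⟩
    have hl : l.length ≤ k := (depthOf_unravel_le_iff _).1 hk
    have h' := h
    simp only [← c.map_root] at h'
    obtain ⟨l', n', hp, rfl, rfl⟩ := c.exists_lift Z.root
      (by rwa [c.level_root]) h'
    exact ⟨⟨⟨(l', n'), hp⟩,
      (depthOf_unravel_le_iff _).2 ((length_mapPath _ _).symm.trans_le hl)⟩, rfl⟩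
  refine ⟨Equiv.ofBijective F ⟨inj, surj⟩, ?_, fun p q => c.prop_iff p _, fun i q r => ⟨?_, ?_⟩⟩
  · exact Subtype.ext (Subtype.ext (Prod.ext rfl c.map_root))
  · rintro ⟨hact, hl⟩
    exact ⟨c.map_act _ _ _ hact, by
      change mapPath f r.1.1.1 = mapPath f q.1.1.1 ++ [(i, f r.1.1.2)]
      rw [hl, mapPath_concat]⟩
  -- The map `f` need not reflect transitions. The one required is the last fact of the path
  -- recorded by `r`, whose remaining part equals the path of `q` by uniqueness of lifts.
  · rintro ⟨-, hl⟩
    obtain ⟨⟨⟨l, n⟩, hp⟩, hk⟩ := r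
    change mapPath f l = mapPath f q.1.1.1 ++ [(i, f n)] at hl
    change Z.act i q.1.1.2 n ∧ l = q.1.1.1 ++ [(i, n)]
    induction l using List.reverseRecOn with
    | nil => simp [mapPath] at hl
    | append_singleton l a _ =>
      obtain ⟨j, t⟩ := a
      obtain ⟨s, hs, hact, rfl⟩ := Z.isPath_concat.1 hp
      rw [mapPath_concat] at hl
      obtain ⟨hl', e⟩ := List.append_inj' hl rfl
      obtain rfl : j = i := by simpa using e
      obtain rfl := c.lift_unique hs q.1.2 hl'
      rw [hs.unique q.1.2] at hact
      exact ⟨hact, rfl⟩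

/-! ### Equal types give isomorphic unravelings -/

/-- Equality of the multisets of children says that for each type the two sets of successors of that
type have equal size; the bijections between these fibers are glued together. -/
theorem exists_matching {M : LTS.{u, v, w} P I} {N : LTS.{u, v, x} P I} (hM : M.ImageFinite)
    (hN : N.ImageFinite) {k : ℕ} {m : M.State} {n : N.State}
    (h : bisimType hM (k + 1) m = bisimType hN (k + 1) n) (i : I) :
    ∃ e : {s // M.act i m s} ≃ {s // N.act i n s},
      ∀ s, bisimType hM k s.1 = bisimType hN k (e s).1 := by
  classical
  have hc := congrArg (fun t => BisimType.children t i) h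
  simp only [children_bisimType] at hc
  have fiber : ∀ t, Nonempty ({s : {s // M.act i m s} // bisimType hM k s = t} ≃
      {s : {s // N.act i n s} // bisimType hN k s = t}) := by
    intro t
    have := congrArg (Multiset.count t) hc
    rw [Multiset.count_map, Multiset.count_map] at this
    change ((hM.finite_act i m).toFinset.filter _).card =
      ((hN.finite_act i n).toFinset.filter _).card at this
    refine ⟨(Equiv.subtypeSubtypeEquivSubtypeInter _ (fun s => bisimType hM k s = t)).trans
      (Equiv.trans ?_ (Equiv.subtypeSubtypeEquivSubtypeInter _
        (fun s => bisimType hN k s = t)).symm)⟩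
    refine (Equiv.subtypeEquivRight fun s => ?_).trans
      ((Finset.equivOfCardEq this).trans (Equiv.subtypeEquivRight fun s => ?_))
    · simp [eq_comm]
    · simp [eq_comm]
  let e := fun t => (fiber t).some
  exact ⟨Equiv.ofFiberEquiv e, fun s => (Equiv.ofFiberEquiv_map e s).symm⟩

/-- The matching as a relation between all states, with equality of types as a premise of its
properties only. It can then be chosen for all pairs of states at once. -/
theorem exists_matching_rel {M : LTS.{u, v, w} P I} {N : LTS.{u, v, x} P I} (hM : M.ImageFinite)
    (hN : N.ImageFinite) (k : ℕ) (i : I) (m : M.State) (n : N.State) :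
    ∃ ρ : M.State → N.State → Prop, bisimType hM (k + 1) m = bisimType hN (k + 1) n →
      (∀ s t, ρ s t → M.act i m s ∧ N.act i n t) ∧
      (∀ s, M.act i m s → ∃ t, ρ s t ∧ bisimType hM k s = bisimType hN k t) ∧
      (∀ t, N.act i n t → ∃ s, ρ s t ∧ bisimType hM k s = bisimType hN k t) ∧
      (∀ s t t', ρ s t → ρ s t' → t = t') ∧ ∀ s s' t, ρ s t → ρ s' t → s = s' := by
  by_cases h : bisimType hM (k + 1) m = bisimType hN (k + 1) n
  · obtain ⟨e, he⟩ := exists_matching hM hN h i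
    refine ⟨fun s t => ∃ hs : M.act i m s, (e ⟨s, hs⟩ : N.State) = t, fun _ =>
      ⟨?_, ?_, ?_, ?_, ?_⟩⟩
    · rintro s _ ⟨hs, rfl⟩
      exact ⟨hs, (e ⟨s, hs⟩).2⟩
    · exact fun s hs => ⟨_, ⟨hs, rfl⟩, he ⟨s, hs⟩⟩
    · intro t ht
      have := he (e.symm ⟨t, ht⟩)
      rw [e.apply_symm_apply] at this
      exact ⟨e.symm ⟨t, ht⟩, ⟨(e.symm ⟨t, ht⟩).2, by simp⟩, this⟩
    · rintro s _ _ ⟨_, rfl⟩ ⟨_, rfl⟩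
      rfl
    · rintro s s' _ ⟨hs, rfl⟩ ⟨hs', h⟩
      exact (congrArg Subtype.val (e.injective (Subtype.ext h))).symm
  · exact ⟨fun _ _ => False, fun h' => absurd h' h⟩

/-- The matchings define a common covering `Z` of `M` and `N` by its two projections, and both
unravelings are compared with that of `Z`. -/
theorem isomorphic_of_bisimType_eq {M : LTS.{u, v, w} P I} {N : LTS.{u, v, x} P I}
    (hM : M.ImageFinite) (hN : N.ImageFinite) {k : ℕ}
    (h : bisimType hM k M.root = bisimType hN k N.root) :
    Isomorphic (M.unravel.truncate k) (N.unravel.truncate k) := by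
  choose ρ hρ using exists_matching_rel hM hN
  -- the states of `Z` are the pairs of states of equal type, with the depth of the type
  let Z : LTS.{u, v, max w x} P I :=
    { State := {q : ℕ × M.State × N.State // bisimType hM q.1 q.2.1 = bisimType hN q.1 q.2.2}
      root := ⟨(k, M.root, N.root), h⟩
      prop := fun p q => M.prop p q.1.2.1
      act := fun i q r => q.1.1 = r.1.1 + 1 ∧ ρ r.1.1 i q.1.2.1 q.1.2.2 r.1.2.1 r.1.2.2 }
  -- The depth drops by one along a transition, so the equality of types stored in `q` is the
  -- premise of the matching at depth `r.1.1`.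
  have spec : ∀ i (q r : Z.State), q.1.1 = r.1.1 + 1 → _ := fun i q r e =>
    hρ r.1.1 i q.1.2.1 q.1.2.2 (e ▸ q.2)
  have cM : CoversUpTo k Z M (fun q => q.1.2.1) :=
    { level := fun q => q.1.1
      level_root := rfl
      level_act := fun i q r h => h.1
      map_root := rfl
      prop_iff := fun p q => Iff.rfl
      map_act := fun i q r h => ((spec i q r h.1).1 _ _ h.2).1
      inj := by
        rintro i q ⟨⟨j, s, t⟩, hst⟩ ⟨⟨j', s', t'⟩, hst'⟩ h h' e
        obtain rfl : s = s' := e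
        obtain rfl : j = j' := Nat.succ_injective (h.1.symm.trans h'.1)
        obtain rfl := (spec i q _ h.1).2.2.2.1 _ _ _ h.2 h'.2
        rfl
      surj := by
        rintro i ⟨⟨_ | j, s, t⟩, hst⟩ n hpos hn
        · exact absurd hpos (lt_irrefl 0)
        · obtain ⟨n', hn', e⟩ := (hρ j i s t hst).2.1 n hn
          exact ⟨⟨(j, n, n'), e⟩, ⟨rfl, hn'⟩, rfl⟩ }
  have cN : CoversUpTo k Z N (fun q => q.1.2.2) :=
    { level := fun q => q.1.1
      level_root := rfl
      level_act := fun i q r h => h.1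
      map_root := rfl
      prop_iff := fun p q => by
        have := congrArg BisimType.letters q.2
        rw [letters_bisimType, letters_bisimType] at this
        exact Set.ext_iff.1 this p
      map_act := fun i q r h => ((spec i q r h.1).1 _ _ h.2).2
      inj := by
        rintro i q ⟨⟨j, s, t⟩, hst⟩ ⟨⟨j', s', t'⟩, hst'⟩ h h' e
        obtain rfl : t = t' := e
        obtain rfl : j = j' := Nat.succ_injective (h.1.symm.trans h'.1)
        obtain rfl := (spec i q _ h.1).2.2.2.2 _ _ _ h.2 h'.2
        rfl
      surj := by
        rintro i ⟨⟨_ | j, s, t⟩, hst⟩ n hpos hn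
        · exact absurd hpos (lt_irrefl 0)
        · obtain ⟨n', hn', e⟩ := (hρ j i s t hst).2.2.1 n hn
          exact ⟨⟨(j, n', n), e⟩, ⟨rfl, hn'⟩, rfl⟩ }
  exact cM.isomorphic.symm.trans cN.isomorphic

end LTS

namespace LTS

variable {P : Type u} {I : Type v}

/-! ### Trees assembled from subtrees -/

/-- The actions of `node`. -/
inductive NodeAct {J : Type} (lab : J → I) (T : J → LTS.{u, v, y} P I) :
    I → Option (Σ j, (T j).State) → Option (Σ j, (T j).State) → Prop
  | root (j : J) : NodeAct lab T (lab j) none (some ⟨j, (T j).root⟩)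
  | sub (j : J) (i : I) (s t : (T j).State) :
      (T j).act i s t → NodeAct lab T i (some ⟨j, s⟩) (some ⟨j, t⟩)

/-- The LTS with a new root that satisfies the letters in `A` and has, for each `j`, a
`lab j`-transition to the root of `T j`. -/
def node {J : Type} (A : Set P) (lab : J → I) (T : J → LTS.{u, v, y} P I) : LTS.{u, v, y} P I where
  State := Option (Σ j, (T j).State)
  root := none
  prop p
    | none => p ∈ A
    | some q => (T q.1).prop p q.2
  act := NodeAct lab T

variable {J : Type} {A : Set P} {lab : J → I} {T : J → LTS.{u, v, y} P I}

/-- The inclusion of a subtree. -/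
def nodeSub (A : Set P) (lab : J → I) (T : J → LTS.{u, v, y} P I) (j : J) (t : (T j).State) :
    (node A lab T).State :=
  some ⟨j, t⟩

theorem act_nodeSub {i : I} {j : J} {s : (T j).State} {r : (node A lab T).State} :
    (node A lab T).act i (nodeSub A lab T j s) r ↔
      ∃ t, r = nodeSub A lab T j t ∧ (T j).act i s t := by
  constructor
  · intro h
    cases h with
    | sub _ _ _ t h => exact ⟨t, rfl, h⟩
  · rintro ⟨t, rfl, h⟩
    exact NodeAct.sub j i s t h

theorem act_node_root {i : I} {r : (node A lab T).State} :
    (node A lab T).act i (node A lab T).root r ↔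
      ∃ j, i = lab j ∧ r = nodeSub A lab T j (T j).root := by
  constructor
  · intro h
    cases h with
    | root j => exact ⟨j, rfl, rfl⟩
  · rintro ⟨j, rfl, rfl⟩
    exact NodeAct.root j

theorem isPath_nodeSub {j : J} {s : (T j).State} {l : List (I × (node A lab T).State)}
    {r : (node A lab T).State} :
    (node A lab T).IsPath (nodeSub A lab T j s) l r ↔
      ∃ l' t, (T j).IsPath s l' t ∧ l = mapPath (nodeSub A lab T j) l' ∧
        r = nodeSub A lab T j t := by
  constructor
  · intro h
    induction l generalizing s with
    | nil => exact ⟨[], s, rfl, rfl, Eq.symm h⟩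
    | cons a l ih =>
      obtain ⟨i, r'⟩ := a
      obtain ⟨hact, hp⟩ := h
      obtain ⟨t, rfl, ht⟩ := act_nodeSub.1 hact
      obtain ⟨l', t', hp', rfl, rfl⟩ := ih hp
      exact ⟨(i, t) :: l', t', ⟨ht, hp'⟩, rfl, rfl⟩
  · rintro ⟨l', t, h, rfl, rfl⟩
    exact h.map fun i m n h => NodeAct.sub j i m n h

theorem isPath_node_nil_or_cons {l : List (I × (node A lab T).State)} {r : (node A lab T).State}
    (h : (node A lab T).IsPath (node A lab T).root l r) :
    (l = [] ∧ r = (node A lab T).root) ∨ ∃ j l' t, (T j).IsPath (T j).root l' t ∧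
      l = (lab j, nodeSub A lab T j (T j).root) :: mapPath (nodeSub A lab T j) l' ∧
        r = nodeSub A lab T j t := by
  cases l with
  | nil => exact Or.inl ⟨rfl, Eq.symm h⟩
  | cons a l =>
    obtain ⟨i, r'⟩ := a
    obtain ⟨hact, hp⟩ := h
    obtain ⟨j, rfl, rfl⟩ := act_node_root.1 hact
    obtain ⟨l', t, hp', rfl, rfl⟩ := isPath_nodeSub.1 hp
    exact Or.inr ⟨j, l', t, hp', rfl, rfl⟩

theorem isPath_node_of_isPath {j : J} {l : List (I × (T j).State)} {t : (T j).State}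
    (h : (T j).IsPath (T j).root l t) :
    (node A lab T).IsPath (node A lab T).root
      ((lab j, nodeSub A lab T j (T j).root) :: mapPath (nodeSub A lab T j) l)
      (nodeSub A lab T j t) :=
  ⟨NodeAct.root j, isPath_nodeSub.2 ⟨l, t, h, rfl, rfl⟩⟩

theorem isTree_node (hT : ∀ j, (T j).IsTree) : (node A lab T).IsTree := by
  rintro (_ | ⟨j, t⟩)
  · refine ⟨[], rfl, fun l h => ?_⟩
    rcases isPath_node_nil_or_cons h with ⟨rfl, -⟩ | ⟨j, l', t, -, -, h⟩
    · rfl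
    · cases h
  · obtain ⟨l, hl, hu⟩ := hT j t
    refine ⟨_, isPath_node_of_isPath hl, fun l' h => ?_⟩
    rcases isPath_node_nil_or_cons h with ⟨-, e⟩ | ⟨j', l'', t', hp, rfl, e⟩
    · cases e
    · cases e
      rw [hu l'' hp]

theorem depth_node_le {k : ℕ} (hT : ∀ j, (T j).IsTree) (hk : ∀ j, (T j).depth ≤ k) :
    (node A lab T).depth ≤ (k + 1 : ℕ) := by
  refine iSup_le ?_
  rintro (_ | ⟨j, t⟩)
  · exact (depthOf_root (node A lab T)).trans_le bot_le
  · obtain ⟨l, hl, -⟩ := hT j t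
    refine (depthOf_le_of_isPath (isPath_node_of_isPath hl)).trans ?_
    have := (le_iSup (T j).depthOf t).trans (hk j)
    rw [(hT j).depthOf_eq hl, Nat.cast_le] at this
    rw [Nat.cast_le]
    simpa [length_mapPath] using this

theorem depth_node_of_isEmpty [IsEmpty J] : (node A lab T).depth ≤ (0 : ℕ) := by
  refine iSup_le ?_
  rintro (_ | ⟨j, t⟩)
  · exact (depthOf_root (node A lab T)).le
  · exact (IsEmpty.false j).elim

/-- The LTS with another distinguished state. -/
def withRoot (M : LTS.{u, v, w} P I) (m : M.State) : LTS.{u, v, w} P I :=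
  { M with root := m }

theorem ImageFinite.withRoot {M : LTS.{u, v, w} P I} (hM : M.ImageFinite) (m : M.State) :
    (M.withRoot m).ImageFinite := hM

/-- A homomorphism from `node A lab T` consists of an image of each root of a subtree and
homomorphisms from the subtrees. -/
def nodeHomEquiv {M : LTS.{u, v, w} P I} {m : M.State} (hA : ∀ p ∈ A, M.prop p m) :
    Hom (node A lab T) (M.withRoot m) ≃
      ∀ j, Σ s : {s // M.act (lab j) m s}, Hom (T j) (M.withRoot s.1) where
  toFun f j := ⟨⟨f.toFun (nodeSub A lab T j (T j).root), by
      have := f.map_act (lab j) (node A lab T).root _ (NodeAct.root j)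
      rwa [f.map_root] at this⟩,
    { toFun := fun t => f.toFun (nodeSub A lab T j t)
      map_root := rfl
      map_prop := fun p t h => f.map_prop p (nodeSub A lab T j t) h
      map_act := fun i s t h => f.map_act i _ _ (NodeAct.sub j i s t h) }⟩
  invFun g :=
    { toFun := fun
        | none => m
        | some q => (g q.1).2.toFun q.2
      map_root := rfl
      map_prop := by
        rintro p (_ | ⟨j, t⟩) h
        · exact hA p h
        · exact (g j).2.map_prop p t h
      map_act := by
        rintro i _ _ (j | ⟨j, _, s, t, h⟩)
        · have := (g j).1.2
          rw [← show (g j).2.toFun (T j).root = (g j).1.1 from (g j).2.map_root] at this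
          exact this
        · exact (g j).2.map_act i s t h }
  left_inv f := by
    refine Hom.ext ?_
    rintro (_ | ⟨j, t⟩)
    · exact f.map_root.symm
    · rfl
  right_inv g := by
    -- The image `s` of the subtree's root is made a variable, so that `hr` can eliminate it despite
    -- the dependent pair.
    have eta : ∀ (j : J) (s : M.State) (hs : M.act (lab j) m s) (f : (T j).State → M.State)
        (hr : f (T j).root = s) (hp : ∀ p t, (T j).prop p t → M.prop p (f t))
        (ha : ∀ i t t', (T j).act i t t' → M.act i (f t) (f t'))
        (h : M.act (lab j) m (f (T j).root)),
        (⟨⟨f (T j).root, h⟩, ⟨f, rfl, hp, ha⟩⟩ :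
          Σ s : {s // M.act (lab j) m s}, Hom (T j) (M.withRoot s.1)) =
            ⟨⟨s, hs⟩, ⟨f, hr, hp, ha⟩⟩ := by
      rintro j s hs f rfl hp ha h
      rfl
    exact funext fun j => eta j (g j).1.1 (g j).1.2 (g j).2.toFun (g j).2.map_root
      (g j).2.map_prop (g j).2.map_act _

-- The subtrees are mapped independently of each other, which gives the product; the choice of a
-- successor for the root of each gives the sum. The indicator is the condition at the new root.
open Classical in
theorem homCount_node [Fintype J] {M : LTS.{u, v, w} P I} (hM : M.ImageFinite) (m : M.State)
    (hT : ∀ j, (T j).IsTree) (hfin : ∀ j, Finite (T j).State) :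
    homCount (node A lab T) (M.withRoot m) = (if A ⊆ {p | M.prop p m} then 1 else 0) *
      ∏ j, ∑ s ∈ (hM.finite_act (lab j) m).toFinset, homCount (T j) (M.withRoot s) := by
  split_ifs with hA
  · rw [one_mul, homCount, Nat.card_congr (nodeHomEquiv hA), Nat.card_pi]
    refine Finset.prod_congr rfl fun j _ => ?_
    have : Fintype {s // M.act (lab j) m s} := (hM.finite_act (lab j) m).fintype
    have : ∀ s : {s // M.act (lab j) m s}, Finite (Hom (T j) (M.withRoot s.1)) :=
      fun s => (hT j).finite_hom (hM.withRoot _)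
    rw [Nat.card_sigma]
    exact (Finset.sum_subtype _ (by simp) fun s => homCount (T j) (M.withRoot s)).symm
  · rw [zero_mul, homCount]
    have : IsEmpty (Hom (node A lab T) (M.withRoot m)) := ⟨fun f => hA fun p hp => by
      have := f.map_prop p (node A lab T).root hp
      rwa [f.map_root] at this⟩
    exact Nat.card_of_isEmpty

end LTS

/-! ### Tree shapes and their counts as functions of types -/

/-- Descriptions of finite trees of depth at most `k`: the letters at the root and, for positive
depth, the list of the labeled subtrees. -/
def TreeShape (P : Type u) (I : Type v) : ℕ → Type (max u v)
  | 0 => ULift.{v} (Set P)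
  | k + 1 => Set P × List (I × TreeShape P I k)

namespace TreeShape

variable {P : Type u} {I : Type v}

/-- Indexing the subtrees by positions keeps repeated list entries as separate copies, and leaves
the universe of the states free. -/
def toLTS : {k : ℕ} → TreeShape P I k → LTS.{u, v, y} P I
  | 0, s => LTS.node (J := Fin 0) s.down Fin.elim0 Fin.elim0
  | _ + 1, s => LTS.node (J := Fin s.2.length) s.1 (fun j => s.2[j].1) (fun j => s.2[j].2.toLTS)

open Classical in
/-- The number of homomorphisms to a state of a given type. -/
noncomputable def count : {k : ℕ} → TreeShape P I k → BisimType P I k → ℕ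
  | 0, s, t => if s.down ⊆ t.letters then 1 else 0
  | _ + 1, s, t => (if s.1 ⊆ t.letters then 1 else 0) *
      (s.2.map fun c => ((t.children c.1).map c.2.count).sum).prod

theorem toLTS_mem_finiteTrees {k : ℕ} (s : TreeShape P I k) :
    toLTS.{u, v, y} s ∈ LTS.finiteTrees P I k := by
  induction k with
  | zero =>
    exact ⟨inferInstanceAs (Finite (Option (Σ j : Fin 0, _))), LTS.isTree_node (fun j => j.elim0),
      LTS.depth_node_of_isEmpty⟩
  | succ k ih =>
    refine ⟨?_, LTS.isTree_node fun j => (ih _).2.1,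
      LTS.depth_node_le (fun j => (ih _).2.1) fun j => (ih _).2.2⟩
    have : ∀ j : Fin s.2.length, Finite (toLTS.{u, v, y} s.2[j].2).State := fun j => (ih _).1
    exact inferInstanceAs (Finite (Option (Σ j : Fin s.2.length, (toLTS s.2[j].2).State)))

theorem homCount_toLTS {M : LTS.{u, v, w} P I} (hM : M.ImageFinite) {k : ℕ}
    (s : TreeShape P I k) (m : M.State) :
    LTS.homCount (toLTS.{u, v, y} s) (M.withRoot m) = s.count (LTS.bisimType hM k m) := by
  induction k generalizing m with
  | zero =>
    rw [toLTS, LTS.homCount_node hM m (fun j => j.elim0) (fun j => j.elim0), count,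
      LTS.letters_bisimType]
    simp
  | succ k ih =>
    rw [toLTS, LTS.homCount_node hM m (fun j => (toLTS_mem_finiteTrees _).2.1)
      (fun j => (toLTS_mem_finiteTrees _).1), count, LTS.letters_bisimType]
    congr 1
    rw [← Fin.prod_univ_fun_getElem]
    refine Finset.prod_congr rfl fun j _ => ?_
    simp only [ih, LTS.children_bisimType, Multiset.map_map]
    rfl

theorem exists_count_eq_one (k : ℕ) :
    ∃ s : TreeShape P I k, ∀ t : BisimType P I k, s.count t = 1 := by
  cases k with
  | zero => exact ⟨⟨∅⟩, fun t => by simp [count]⟩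
  | succ k => exact ⟨(∅, []), fun t => by simp [count]⟩

-- Gluing two trees at their roots: the letters are united and the lists of subtrees concatenated.
open Classical in
theorem exists_count_eq_mul {k : ℕ} (s s' : TreeShape P I k) :
    ∃ r : TreeShape P I k, ∀ t : BisimType P I k, r.count t = s.count t * s'.count t := by
  cases k with
  | zero =>
    refine ⟨⟨s.down ∪ s'.down⟩, fun t => ?_⟩
    change (if s.down ∪ s'.down ⊆ t.letters then 1 else 0) = _
    by_cases h : s.down ⊆ t.letters <;> by_cases h' : s'.down ⊆ t.letters <;>
      simp [count, Set.union_subset_iff, h, h']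
  | succ k =>
    refine ⟨(s.1 ∪ s'.1, s.2 ++ s'.2), fun t => ?_⟩
    change (if s.1 ∪ s'.1 ⊆ t.letters then 1 else 0) *
      ((s.2 ++ s'.2).map fun c => ((t.children c.1).map c.2.count).sum).prod = _
    rw [List.map_append, List.prod_append]
    by_cases h : s.1 ⊆ t.letters <;> by_cases h' : s'.1 ⊆ t.letters <;>
      simp [count, Set.union_subset_iff, h, h']

/-- Tested by the one-state tree whose root carries the letters of `t`: its count is `1` at `t`, and
`0` at `t'` unless the inclusion holds. -/
theorem letters_subset_of_count_eq {k : ℕ} {t t' : BisimType P I k}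
    (h : ∀ s : TreeShape P I k, s.count t = s.count t') : t.letters ⊆ t'.letters := by
  cases k with
  | zero =>
    have := h ⟨t.letters⟩
    by_contra hn
    simp [count, hn] at this
  | succ k =>
    have := h (t.letters, [])
    by_contra hn
    simp [count, hn] at this

theorem eq_of_count_eq {k : ℕ} (t t' : BisimType P I k)
    (h : ∀ s : TreeShape P I k, s.count t = s.count t') : t = t' := by
  have hl : t.letters = t'.letters := (letters_subset_of_count_eq h).antisymm
    (letters_subset_of_count_eq fun s => (h s).symm)
  induction k with
  | zero => exact BisimType.ext_zero hl
  | succ k ih =>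
    have sep : ∀ a b : BisimType P I k, (∀ s : TreeShape P I k, s.count a = s.count b) → a = b :=
      fun a b hab => ih a b hab ((letters_subset_of_count_eq hab).antisymm
        (letters_subset_of_count_eq fun s => (hab s).symm))
    refine BisimType.ext_succ hl fun i => Multiset.eq_of_sum_map_eq
      (fun s : TreeShape P I k => s.count) (exists_count_eq_one k) exists_count_eq_mul sep _ _ ?_
    intro s
    -- A root without letters and with the single subtree `s` below an `i`-transition counts the sum
    -- of `s.count` over the `i`-children.
    have := h (∅, [(i, s)])
    simpa [count] using this

end TreeShape

/-! ### From counts to types; the unraveling by states -/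

namespace LTS

variable {P : Type u} {I : Type v}

theorem bisimType_eq_of_homCount_eq {M : LTS.{u, v, w} P I} {N : LTS.{u, v, x} P I}
    (hM : M.ImageFinite) (hN : N.ImageFinite) {k : ℕ}
    (h : ∀ T ∈ finiteTrees.{u, v, y} P I k, homCount T M = homCount T N) :
    bisimType hM k M.root = bisimType hN k N.root := by
  refine TreeShape.eq_of_count_eq _ _ fun s => ?_
  rw [← TreeShape.homCount_toLTS.{u, v, w, y} hM, ← TreeShape.homCount_toLTS.{u, v, x, y} hN]
  exact h _ s.toLTS_mem_finiteTrees

/-! ### The unraveling that records only states -/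

theorem IsPath.isChain {M : LTS.{u, v, w} P I} {l : List (I × M.State)} {m n : M.State}
    (h : M.IsPath m l n) : (m :: l.map Prod.snd).IsChain fun m n => ∃ i, M.act i m n := by
  induction l generalizing m with
  | nil => exact List.IsChain.singleton _
  | cons a l ih => exact List.IsChain.cons_cons ⟨_, h.1⟩ (ih h.2)

theorem IsPath.getLast? {M : LTS.{u, v, w} P I} {l : List (I × M.State)} {m n : M.State}
    (h : M.IsPath m l n) : (m :: l.map Prod.snd).getLast? = some n := by
  induction l generalizing m with
  | nil => cases h; rfl
  | cons a l ih => rw [List.map_cons, List.getLast?_cons_cons]; exact ih h.2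

theorem exists_isPath_of_isChain {M : LTS.{u, v, w} P I} {L : List M.State} {m : M.State}
    (h : (m :: L).IsChain fun m n => ∃ i, M.act i m n) :
    ∃ l n, M.IsPath m l n ∧ l.map Prod.snd = L := by
  induction L generalizing m with
  | nil => exact ⟨[], m, rfl, rfl⟩
  | cons s L ih =>
    obtain ⟨⟨i, hi⟩, h⟩ := List.isChain_cons_cons.1 h
    obtain ⟨l, n, hp, rfl⟩ := ih h
    exact ⟨(i, s) :: l, n, ⟨hi, hp⟩, rfl⟩

/-- Two consecutive states determine the action between them, so the visited states determine the
path. -/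
theorem DisjointActions.eq_of_map_snd_eq {M : LTS.{u, v, w} P I} (hM : M.DisjointActions)
    {l l' : List (I × M.State)} {m n n' : M.State} (h : M.IsPath m l n) (h' : M.IsPath m l' n')
    (e : l.map Prod.snd = l'.map Prod.snd) : l = l' := by
  induction l generalizing m l' with
  | nil => exact (List.map_eq_nil_iff.1 e.symm).symm
  | cons a l ih =>
    cases l' with
    | nil => simp at e
    | cons b l' =>
      obtain ⟨i, s⟩ := a
      obtain ⟨j, t⟩ := b
      simp only [List.map_cons, List.cons.injEq] at e
      obtain ⟨rfl, e⟩ := e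
      obtain rfl := hM _ _ _ _ h.1 h'.1
      rw [ih h.2 h'.2 e]

theorem DisjointActions.isomorphic_stateUnravel {M : LTS.{u, v, w} P I} (hM : M.DisjointActions) :
    Isomorphic M.unravel M.stateUnravel := by
  let F : M.unravel.State → M.stateUnravel.State := fun q =>
    ⟨M.root :: q.1.1.map Prod.snd, rfl, q.2.isChain⟩
  have inj : Function.Injective F := by
    intro q r h
    have h1 : q.1.1 = r.1.1 :=
      hM.eq_of_map_snd_eq q.2 r.2 (List.cons.inj (congrArg Subtype.val h)).2
    refine Subtype.ext (Prod.ext h1 ?_)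
    have := q.2
    rw [h1] at this
    exact this.unique r.2
  have surj : Function.Surjective F := by
    rintro ⟨_ | ⟨m, L⟩, hr, hc⟩
    · simp at hr
    · obtain rfl : m = M.root := by simpa using hr
      obtain ⟨l, n, hp, rfl⟩ := exists_isPath_of_isChain hc
      exact ⟨⟨(l, n), hp⟩, rfl⟩
  refine ⟨Equiv.ofBijective F ⟨inj, surj⟩, rfl, fun p q => ⟨?_, ?_⟩, fun i q r => ⟨?_, ?_⟩⟩
  · exact fun h => ⟨q.1.2, q.2.getLast?, h⟩
  · rintro ⟨m, hm, h⟩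
    rwa [← Option.some.inj (q.2.getLast?.symm.trans hm)] at h
  · rintro ⟨hact, hl⟩
    refine ⟨q.1.2, r.1.2, q.2.getLast?, hact, ?_⟩
    change M.root :: r.1.1.map Prod.snd = (M.root :: q.1.1.map Prod.snd) ++ [r.1.2]
    simp [hl]
  · rintro ⟨m, n, hm, hact, hl⟩
    rw [← Option.some.inj (q.2.getLast?.symm.trans hm)] at hact
    have hp : M.IsPath M.root (q.1.1 ++ [(i, n)]) n := M.isPath_concat.2 ⟨_, q.2, hact, rfl⟩
    have : r = ⟨(q.1.1 ++ [(i, n)], n), hp⟩ := by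
      refine inj (Subtype.ext (hl.trans ?_))
      change (M.root :: q.1.1.map Prod.snd) ++ [n] = M.root :: (q.1.1 ++ [(i, n)]).map Prod.snd
      simp
    rw [this]
    exact ⟨hact, rfl⟩

end LTS

/-! ### The equivalence -/

theorem mainTheorem1 {P : Type u} {I : Type v} [Finite P] [Finite I]
    (M : LTS.{u, v, w} P I) (N : LTS.{u, v, x} P I)
    (hM : M.ImageFinite) (hN : N.ImageFinite) (k : ℕ) :
    (∀ T ∈ LTS.finiteTrees.{u, v, y} P I k, Finite (LTS.Hom T M) ∧ Finite (LTS.Hom T N)) ∧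
    List.TFAE [
      ∀ T ∈ LTS.finiteTrees.{u, v, y} P I k, LTS.homCount T M = LTS.homCount T N,
      LTS.Isomorphic (M.unravel.truncate k) (N.unravel.truncate k),
      GML.EquivUpTo k M N] ∧
    (M.DisjointActions → N.DisjointActions →
      List.TFAE [
        ∀ T ∈ LTS.finiteTrees.{u, v, y} P I k, LTS.homCount T M = LTS.homCount T N,
        LTS.Isomorphic (M.stateUnravel.truncate k) (N.stateUnravel.truncate k),
        GML.EquivUpTo k M N]) := by
  have main : List.TFAE [
      ∀ T ∈ LTS.finiteTrees.{u, v, y} P I k, LTS.homCount T M = LTS.homCount T N,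
      LTS.Isomorphic (M.unravel.truncate k) (N.unravel.truncate k),
      GML.EquivUpTo k M N] := by
    tfae_have 1 → 3 := fun h =>
      (LTS.equivUpTo_iff_bisimType_eq hM hN k).2 (LTS.bisimType_eq_of_homCount_eq hM hN h)
    tfae_have 3 → 2 := fun h =>
      LTS.isomorphic_of_bisimType_eq hM hN ((LTS.equivUpTo_iff_bisimType_eq hM hN k).1 h)
    tfae_have 2 → 1 := fun h T hT => by
      rw [← hT.2.1.homCount_unravel M hT.2.2, ← hT.2.1.homCount_unravel N hT.2.2,
        h.homCount_eq T]
    tfae_finish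
  refine ⟨fun T ⟨hfin, hT, _⟩ => ⟨hT.finite_hom hM, hT.finite_hom hN⟩, main, fun dM dN => ?_⟩
  have isoM := dM.isomorphic_stateUnravel.truncate k
  have isoN := dN.isomorphic_stateUnravel.truncate k
  have iff : LTS.Isomorphic (M.unravel.truncate k) (N.unravel.truncate k) ↔
      LTS.Isomorphic (M.stateUnravel.truncate k) (N.stateUnravel.truncate k) :=
    ⟨fun h => isoM.symm.trans (h.trans isoN), fun h => isoM.trans (h.trans isoN.symm)⟩
  rwa [iff] at main
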